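/- Let $(\mathfrak A_1,\theta_1)$ and $(\mathfrak A_2,\theta_2)$ be $\mathbb Z_2$-graded unital $C^*$-algebras, i.e. $\theta_i$ is a $*$-automorphism of $\mathfrak A_i$ with $\theta_i^2=\mathrm{id}$; an element $a\in\mathfrak A_i$ is homogeneous if it is even ($\theta_i(a)=a$) or odd ($\theta_i(a)=-a$). Their Fermi product $\mathfrak A_1\,\hat\otimes_F\,\mathfrak A_2$ is the algebraic tensor product $\mathfrak A_1\odot\mathfrak A_2$ over $\mathbb C$ with the product and involution determined, for homogeneous elements, by $$(a_1\otimes a_2)(a_1'\otimes a_2')=\varepsilon(a_2,a_1')\,a_1a_1'\otimes a_2a_2',\qquad (a_1\otimes a_2)^*=\varepsilon(a_1,a_2)\,a_1^*\otimes a_2^*,$$ where $\varepsilon(a,b)=-1$ if $a$ and $b$ are both odd, and $\varepsilon(a,b)=1$ otherwise. For $x\in\mathfrak A_1\,\hat\otimes_F\,\mathfrak A_2$ put $$\|x\|_{\max}=\sup\{\|\pi(x)\| : \pi \text{ a unital } *\text{-representation of } \mathfrak A_1\,\hat\otimes_F\,\mathfrak A_2 \text{ by bounded operators on a Hilbert space}\},$$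 $$\|x\|_{\min}=\sup\{\|\pi_{\omega_1\times\omega_2}(x)\| : \omega_i \text{ a state of } \mathfrak A_i \text{ with } \omega_i\circ\theta_i=\omega_i,\ i=1,2\},$$ where $\omega_1\times\omega_2$ is the linear functional with $(\omega_1\times\omega_2)(a_1\otimes a_2)=\omega_1(a_1)\omega_2(a_2)$ and $\pi_{\omega_1\times\omega_2}$ is its GNS representation, i.e. the $*$-representation by bounded operators on a Hilbert space, unique up to unitary equivalence, with a cyclic vector $\xi$ such that $\langle \xi,\pi_{\omega_1\times\omega_2}(x)\xi\rangle=(\omega_1\times\omega_2)(x)$ for all $x$ (inner product linear in the second variable). (The supremum over the empty set is $0$; it occurs only if one of the algebras is $\{0\}$.) Then both suprema are finite, and both the maximal norm $\|\cdot\|_{\max}$ and the spatial norm $\|\cdot\|_{\min}$ are $C^*$-cross norms on $\mathfrak A_1\,\hat\otimes_F\,\mathfrak A_2$: each is a norm on this complex vector space which satisfies $\|xy\|\le\|x\|\,\|y\|$ and $\|x^*x\|=\|x\|^2$ for all $x,y$, and $$\|a_1\otimes a_2\|=\|a_1\|\,\|a_2\|\qquad\text{for all homogeneous } a_1\in\mathfrak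 A_1,\ a_2\in\mathfrak A_2.$$ -/

import Mathlib

open scoped TensorProduct ComplexOrder

universe u v w

noncomputable section

/-- A `ℤ/2`-grading of a unital C⋆-algebra: an involutive ⋆-automorphism `θ`. -/
structure Z2Grading (A : Type u) [CStarAlgebra A] where
  /-- The grading automorphism. -/
  θ : A ≃⋆ₐ[ℂ] A
  involutive : ∀ a, θ (θ a) = a

/-- The nontrivial character of `ℤ/2`. Degrees are written additively: `0` is the even degree,
`1` the odd degree. -/
def gradeSign (i : ZMod 2) : ℂ := if i = 0 then 1 else -1

/-- The sign which is `-1` if both degrees are odd and `1` otherwise. -/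
def fermiSign (i j : ZMod 2) : ℂ := if i = 1 ∧ j = 1 then -1 else 1

namespace Z2Grading

variable {A : Type u} [CStarAlgebra A] (g : Z2Grading A)

/-- The homogeneous component of degree `i`: the even part `{a | θ a = a}` for `i = 0`, the odd
part `{a | θ a = -a}` for `i = 1`. -/
def part (i : ZMod 2) : Submodule ℂ A where
  carrier := {a | g.θ a = gradeSign i • a}
  add_mem' {a b} ha hb := by
    simp only [Set.mem_ofPred_eq] at *
    rw [map_add, ha, hb, smul_add]
  zero_mem' := by simp
  smul_mem' c a ha := by
    simp only [Set.mem_ofPred_eq] at *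
    rw [map_smul, ha, smul_comm]

/-- An element is homogeneous if it is even or odd. -/
def IsHomogeneous (a : A) : Prop := ∃ i, a ∈ g.part i

/-- The projection `a ↦ (a ± θ a) / 2` onto the homogeneous component of degree `i`. -/
def proj (i : ZMod 2) : A →ₗ[ℂ] A where
  toFun a := (2⁻¹ : ℂ) • (a + gradeSign i • g.θ a)
  map_add' a b := by
    simp only [map_add, smul_add]
    abel
  map_smul' c a := by
    simp only [map_smul, RingHom.id_apply, smul_add]
    rw [smul_comm (gradeSign i) c, smul_comm (2⁻¹ : ℂ) c, smul_comm (2⁻¹ : ℂ) c]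

lemma mem_part {i : ZMod 2} {a : A} : a ∈ g.part i ↔ g.θ a = gradeSign i • a := Iff.rfl

lemma proj_apply (i : ZMod 2) (a : A) :
    g.proj i a = (2⁻¹ : ℂ) • (a + gradeSign i • g.θ a) := rfl

lemma zmod_two_cases (i : ZMod 2) : i = 0 ∨ i = 1 := by
  revert i; decide

lemma gradeSign_add (i j : ZMod 2) : gradeSign (i + j) = gradeSign i * gradeSign j := by
  obtain rfl | rfl := zmod_two_cases i <;> obtain rfl | rfl := zmod_two_cases j <;>
    simp [gradeSign, show (1 + 1 : ZMod 2) = 0 from rfl]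

lemma gradeSign_mul_self (i : ZMod 2) : gradeSign i * gradeSign i = 1 := by
  unfold gradeSign; split_ifs <;> norm_num

lemma proj_mem (i : ZMod 2) (a : A) : g.proj i a ∈ g.part i := by
  rw [mem_part, proj_apply, map_smul, map_add, map_smul, g.involutive, smul_comm (gradeSign i),
    smul_add (gradeSign i), smul_smul (gradeSign i), gradeSign_mul_self, one_smul, add_comm]

lemma proj_of_mem {i : ZMod 2} (j : ZMod 2) {a : A} (ha : a ∈ g.part i) :
    g.proj j a = if i = j then a else 0 := by
  rw [mem_part] at ha
  have h2 : (2⁻¹ : ℂ) • (a + a) = a := by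
    rw [← two_smul ℂ a, smul_smul]; norm_num
  rw [proj_apply, ha]
  obtain rfl | rfl := zmod_two_cases i <;> obtain rfl | rfl := zmod_two_cases j <;>
    simp only [gradeSign, one_ne_zero, zero_ne_one, if_true, if_false, one_smul, neg_smul,
      neg_neg, add_neg_cancel, smul_zero, h2]

lemma proj_zero_add_proj_one (a : A) : g.proj 0 a + g.proj 1 a = a := by
  simp only [proj_apply, gradeSign, if_true, one_ne_zero, if_false, ← smul_add]
  rw [one_smul, neg_one_smul, show a + g.θ a + (a + -g.θ a) = (2 : ℂ) • a by
    rw [two_smul]; abel, smul_smul]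
  norm_num

lemma star_mem {i : ZMod 2} {a : A} (ha : a ∈ g.part i) : star a ∈ g.part i := by
  rw [mem_part] at *
  rw [map_star, ha, star_smul]
  congr 1
  unfold gradeSign; split_ifs <;> simp

instance : SetLike.GradedMonoid g.part where
  one_mem := by simp [mem_part, gradeSign]
  mul_mem {i j a b} ha hb := by
    rw [mem_part] at *
    rw [map_mul, ha, hb, gradeSign_add, smul_mul_smul_comm]

instance : DirectSum.Decomposition g.part :=
  DirectSum.Decomposition.ofLinearMap g.part
    (∑ i : ZMod 2, DirectSum.lof ℂ (ZMod 2) (fun i => g.part i) i ∘ₗ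
      (g.proj i).codRestrict (g.part i) (g.proj_mem i))
    (by
      ext a
      have : (Finset.univ : Finset (ZMod 2)) = {0, 1} := rfl
      simp [this, g.proj_zero_add_proj_one a])
    (by
      ext i a : 2
      simp only [LinearMap.comp_apply, LinearMap.sum_apply, DirectSum.coeLinearMap_lof,
        LinearMap.id_apply]
      rw [Finset.sum_eq_single i]
      · congr 1
        exact Subtype.ext (by simp [g.proj_of_mem i a.2])
      · intro j _ hj
        rw [show (g.proj j).codRestrict (g.part j) (g.proj_mem j) (a : A) = 0 from
          Subtype.ext (by simp [g.proj_of_mem j a.2, hj.symm]), map_zero]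
      · simp)

instance : GradedAlgebra g.part where

end Z2Grading

variable {A : Type u} [CStarAlgebra A] {B : Type v} [CStarAlgebra B]

/-- The Fermi product: the algebraic tensor product `A ⊗[ℂ] B` with the product
`(a ⊗ b) (a' ⊗ b') = ± aa' ⊗ bb'` for homogeneous `b`, `a'`, the sign being `-1` exactly if both
`b` and `a'` are odd. -/
abbrev FermiProduct (g₁ : Z2Grading A) (g₂ : Z2Grading B) : Type (max u v) :=
  GradedTensorProduct ℂ g₁.part g₂.part

namespace FermiProduct

variable (g₁ : Z2Grading A) (g₂ : Z2Grading B)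

/-- The elementary tensor `a ⊗ b` as an element of the Fermi product. -/
def tmul (a : A) (b : B) : FermiProduct g₁ g₂ := GradedTensorProduct.of ℂ g₁.part g₂.part (a ⊗ₜ b)

/-- The involution `x* = ∑ᵢⱼ ± xᵢⱼ*`, where `xᵢⱼ` is the component of `x` of bidegree `(i, j)`,
the star on the right is that of `A ⊗[ℂ] B`, `(a ⊗ b)* = a* ⊗ b*`, and the sign is `-1` exactly
if `i` and `j` are both odd. -/
instance : Star (FermiProduct g₁ g₂) where
  star x := GradedTensorProduct.of ℂ g₁.part g₂.part
    (∑ i : ZMod 2, ∑ j : ZMod 2, fermiSign i j •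
      star (TensorProduct.map (g₁.proj i) (g₂.proj j)
        ((GradedTensorProduct.of ℂ g₁.part g₂.part).symm x)))

variable {g₁ g₂}

lemma star_def (x : FermiProduct g₁ g₂) : star x = GradedTensorProduct.of ℂ g₁.part g₂.part
    (∑ i : ZMod 2, ∑ j : ZMod 2, fermiSign i j •
      star (TensorProduct.map (g₁.proj i) (g₂.proj j)
        ((GradedTensorProduct.of ℂ g₁.part g₂.part).symm x))) := rfl

lemma star_tmul {i j : ZMod 2} {a : A} {b : B} (ha : a ∈ g₁.part i) (hb : b ∈ g₂.part j) :
    star (tmul g₁ g₂ a b) = fermiSign i j • tmul g₁ g₂ (star a) (star b) := by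
  rw [star_def, tmul, GradedTensorProduct.of_symm_of, Finset.sum_eq_single i,
    Finset.sum_eq_single j]
  · simp [g₁.proj_of_mem i ha, g₂.proj_of_mem j hb, tmul]
  · intro k _ hk
    simp [g₂.proj_of_mem k hb, hk.symm]
  · simp
  · intro k _ hk
    simp [g₁.proj_of_mem k ha, hk.symm]
  · simp

lemma tmul_mul_tmul {j k : ZMod 2} (a : A) {b : B} {a' : A} (b' : B)
    (hb : b ∈ g₂.part j) (ha' : a' ∈ g₁.part k) :
    tmul g₁ g₂ a b * tmul g₁ g₂ a' b' = fermiSign j k • tmul g₁ g₂ (a * a') (b * b') := by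
  have h := GradedTensorProduct.tmul_coe_mul_coe_tmul (R := ℂ) g₁.part g₂.part a ⟨b, hb⟩ ⟨a', ha'⟩ b'
  refine h.trans ?_
  obtain rfl | rfl := Z2Grading.zmod_two_cases j <;>
    obtain rfl | rfl := Z2Grading.zmod_two_cases k <;> simp [fermiSign, tmul]

lemma induction_homogeneous {p : FermiProduct g₁ g₂ → Prop} (x : FermiProduct g₁ g₂)
    (h0 : p 0) (ht : ∀ i j a b, a ∈ g₁.part i → b ∈ g₂.part j → p (tmul g₁ g₂ a b))
    (ha : ∀ x y, p x → p y → p (x + y)) : p x := by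
  induction x using TensorProduct.induction_on with
  | zero => exact h0
  | add x y hx hy => exact ha x y hx hy
  | tmul a b =>
    have : tmul g₁ g₂ a b = tmul g₁ g₂ (g₁.proj 0 a) (g₂.proj 0 b) +
        tmul g₁ g₂ (g₁.proj 0 a) (g₂.proj 1 b) + (tmul g₁ g₂ (g₁.proj 1 a) (g₂.proj 0 b) +
        tmul g₁ g₂ (g₁.proj 1 a) (g₂.proj 1 b)) := by
      simp only [tmul, ← map_add, ← TensorProduct.tmul_add, ← TensorProduct.add_tmul,
        Z2Grading.proj_zero_add_proj_one]
    change p (tmul g₁ g₂ a b)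
    rw [this]
    have h := fun i j => ht i j _ _ (g₁.proj_mem i a) (g₂.proj_mem j b)
    exact ha _ _ (ha _ _ (h 0 0) (h 0 1)) (ha _ _ (h 1 0) (h 1 1))

lemma star_add' (x y : FermiProduct g₁ g₂) : star (x + y) = star x + star y := by
  simp only [star_def, map_add, star_add, smul_add, Finset.sum_add_distrib]

lemma star_smul' (c : ℂ) (x : FermiProduct g₁ g₂) : star (c • x) = star c • star x := by
  simp only [star_def, map_smul, star_smul, map_sum, Finset.smul_sum]
  exact Finset.sum_congr rfl fun i _ => Finset.sum_congr rfl fun j _ => smul_comm _ _ _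

lemma star_fermiSign (i j : ZMod 2) : star (fermiSign i j) = fermiSign i j := by
  unfold fermiSign; split_ifs <;> simp

instance : StarRing (FermiProduct g₁ g₂) where
  star_involutive x := by
    induction x using induction_homogeneous with
    | h0 => simp [star_def]
    | ht i j a b ha hb =>
      rw [star_tmul ha hb, star_smul', star_tmul (g₁.star_mem ha) (g₂.star_mem hb), smul_smul,
        star_fermiSign, star_star, star_star]
      unfold fermiSign; split_ifs <;> simp
    | ha x y hx hy => rw [star_add', star_add', hx, hy]
  star_add := star_add'
  star_mul x y := by
    induction x using induction_homogeneous with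
    | h0 => simp [star_def]
    | ha x x' hx hx' => rw [add_mul, star_add', hx, hx', star_add', mul_add]
    | ht i j a b ha hb =>
      induction y using induction_homogeneous with
      | h0 => simp [star_def]
      | ha y y' hy hy' => rw [mul_add, star_add', hy, hy', star_add', add_mul]
      | ht k l a' b' ha' hb' =>
        rw [tmul_mul_tmul a b' hb ha', star_smul',
          star_tmul (SetLike.mul_mem_graded ha ha') (SetLike.mul_mem_graded hb hb'),
          star_tmul ha hb, star_tmul ha' hb', smul_mul_smul_comm,
          tmul_mul_tmul _ _ (g₂.star_mem hb') (g₁.star_mem ha), smul_smul, smul_smul,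
          star_fermiSign, star_mul, star_mul]
        congr 1
        obtain rfl | rfl := Z2Grading.zmod_two_cases i <;>
          obtain rfl | rfl := Z2Grading.zmod_two_cases j <;>
          obtain rfl | rfl := Z2Grading.zmod_two_cases k <;>
          obtain rfl | rfl := Z2Grading.zmod_two_cases l <;>
          simp [fermiSign, show (1 + 1 : ZMod 2) = 0 from rfl]

instance : StarModule ℂ (FermiProduct g₁ g₂) where
  star_smul := star_smul'

end FermiProduct

/-- A state of a unital C⋆-algebra: a positive normalized linear functional. -/
structure IsState (φ : A →ₗ[ℂ] ℂ) : Prop where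
  nonneg : ∀ a, 0 ≤ φ (star a * a)
  map_one : φ 1 = 1

/-- An even state of a graded C⋆-algebra: a state invariant under the grading automorphism. -/
structure IsEvenState (g : Z2Grading A) (φ : A →ₗ[ℂ] ℂ) : Prop extends IsState φ where
  even : ∀ a, φ (g.θ a) = φ a

/-- The product functional `ω₁ × ω₂` on the Fermi product, `a ⊗ b ↦ ω₁ a * ω₂ b`. -/
def prodFunctional (g₁ : Z2Grading A) (g₂ : Z2Grading B) (ω₁ : A →ₗ[ℂ] ℂ) (ω₂ : B →ₗ[ℂ] ℂ) :
    FermiProduct g₁ g₂ →ₗ[ℂ] ℂ :=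
  LinearMap.mul' ℂ ℂ ∘ₗ TensorProduct.map ω₁ ω₂ ∘ₗ
    (GradedTensorProduct.of ℂ g₁.part g₂.part).symm.toLinearMap

/-- `(H, π, ξ)` is the GNS representation of the functional `φ` on a ⋆-algebra: `π` is a
⋆-representation on the Hilbert space `H` by bounded operators with cyclic vector `ξ`, and
`φ x = ⟨ξ, π x ξ⟩`. These properties determine `(H, π, ξ)` up to unitary equivalence. -/
structure IsGNS {R : Type w} [Ring R] [Algebra ℂ R] [StarRing R]
    {H : Type*} [NormedAddCommGroup H] [InnerProductSpace ℂ H] [CompleteSpace H]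
    (φ : R →ₗ[ℂ] ℂ) (π : R →⋆ₐ[ℂ] (H →L[ℂ] H)) (ξ : H) : Prop where
  cyclic : Dense (Set.range fun x => π x ξ)
  inner_eq : ∀ x, inner ℂ ξ (π x ξ) = φ x

/-- The values `‖π x‖`, where `π` runs over the ⋆-representations of the Fermi product on Hilbert
spaces. Hilbert spaces in the universe of the Fermi product suffice, since `‖π x‖` is the
supremum of the norms of the restrictions of `π x` to the cyclic subspaces of `π`. -/
def maxNormSet (g₁ : Z2Grading A) (g₂ : Z2Grading B) (x : FermiProduct g₁ g₂) : Set ℝ :=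
  {r | ∃ (H : Type (max u v)) (_ : NormedAddCommGroup H) (_ : InnerProductSpace ℂ H)
    (_ : CompleteSpace H) (π : FermiProduct g₁ g₂ →⋆ₐ[ℂ] (H →L[ℂ] H)), r = ‖π x‖}

/-- The maximal norm on the Fermi product. -/
def maxNorm (g₁ : Z2Grading A) (g₂ : Z2Grading B) (x : FermiProduct g₁ g₂) : ℝ :=
  sSup (maxNormSet g₁ g₂ x)

/-- The values `‖π x‖`, where `π` is the GNS representation of `ω₁ × ω₂` for even states
`ω₁`, `ω₂`. -/
def spatialNormSet (g₁ : Z2Grading A) (g₂ : Z2Grading B) (x : FermiProduct g₁ g₂) : Set ℝ :=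
  {r | ∃ (ω₁ : A →ₗ[ℂ] ℂ) (ω₂ : B →ₗ[ℂ] ℂ) (_ : IsEvenState g₁ ω₁) (_ : IsEvenState g₂ ω₂)
    (H : Type (max u v)) (_ : NormedAddCommGroup H) (_ : InnerProductSpace ℂ H)
    (_ : CompleteSpace H) (π : FermiProduct g₁ g₂ →⋆ₐ[ℂ] (H →L[ℂ] H)) (ξ : H),
    IsGNS (prodFunctional g₁ g₂ ω₁ ω₂) π ξ ∧ r = ‖π x‖}

/-- The spatial norm on the Fermi product. -/
def spatialNorm (g₁ : Z2Grading A) (g₂ : Z2Grading B) (x : FermiProduct g₁ g₂) : ℝ :=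
  sSup (spatialNormSet g₁ g₂ x)

/-- A C⋆-norm on a complex ⋆-algebra (not necessarily complete). -/
structure IsCStarNorm {R : Type w} [Ring R] [Algebra ℂ R] [StarRing R] (N : R → ℝ) : Prop where
  add_le : ∀ x y, N (x + y) ≤ N x + N y
  smul : ∀ (c : ℂ) (x : R), N (c • x) = ‖c‖ * N x
  eq_zero_iff : ∀ x, N x = 0 ↔ x = 0
  mul_le : ∀ x y, N (x * y) ≤ N x * N y
  star_mul_self : ∀ x, N (star x * x) = N x ^ 2

/-- A C⋆-norm on the Fermi product is cross if `‖a ⊗ b‖ = ‖a‖ ‖b‖` for homogeneous `a`, `b`. -/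
structure IsCrossNorm (g₁ : Z2Grading A) (g₂ : Z2Grading B) (N : FermiProduct g₁ g₂ → ℝ) : Prop
    extends IsCStarNorm N where
  cross : ∀ (a : A) (b : B), g₁.IsHomogeneous a → g₂.IsHomogeneous b →
    N (FermiProduct.tmul g₁ g₂ a b) = ‖a‖ * ‖b‖

end

/-! Both norms are suprema of C⋆-seminorms `‖π x‖` over families of representations, and the
C⋆-identities pass to a pointwise bounded supremum (`isCStarNorm_sSup`). Three points remain.

Upper bound: `a ⊗ b = (a ⊗ 1)(1 ⊗ b)`, and ⋆-homomorphisms of C⋆-algebras are contractive, so `‖π (a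
⊗ b)‖ ≤ ‖a‖ ‖b‖` for every `π` (`norm_map_tmul_le`). This gives finiteness and half of the cross
property.

Existence of representations: for even states `ω₁`, `ω₂` the form `(ω₁ × ω₂)(x* y)` is the inner
product of the images of `x` and `y` in the ordinary tensor product of the two GNS spaces. Where the
Fermi sign could matter, an even state vanishes (`prodFunctional_star_mul_eq_inner`). Hence `ω₁ ×
ω₂` is positive and has a bounded GNS representation.

Enough even states: averaging a norming state with its translate by `θ` loses at most half of its
value at `a* a`, and nothing if `a` is homogeneous (`exists_isEvenState_apply_star_mul_self`). The
first bound makes products of even states separate points, hence definiteness; the second gives the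
lower cross bound. As the spatial family lies in the family of all representations, one argument
serves both norms (`isCrossNorm_sSup`). -/

noncomputable section

/-! ### Positive functionals and the GNS construction -/

section PositiveFunctional

variable {R : Type w} [Ring R] [Algebra ℂ R] [StarRing R]

/-- Polarization: the values of `φ` at the squares of `1`, `x`, `1 + x` and `1 + i x` are real. The
third compares imaginary parts, the fourth real parts. -/
lemma LinearMap.map_star_of_nonneg_star_mul_self [StarModule ℂ R] {φ : R →ₗ[ℂ] ℂ}
    (hφ : ∀ x, 0 ≤ φ (star x * x)) (x : R) : φ (star x) = star (φ x) := by
  have h0 := (Complex.nonneg_iff.mp (hφ 1)).2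
  have hx := (Complex.nonneg_iff.mp (hφ x)).2
  have h1 := (Complex.nonneg_iff.mp (hφ (1 + x))).2
  have h2 := (Complex.nonneg_iff.mp (hφ (1 + Complex.I • x))).2
  simp [add_mul, mul_add] at h0 h1 h2
  apply Complex.ext
  · simp; linarith
  · simp; linarith

/-- The Gelfand–Naimark–Segal construction for a positive functional on a unital ⋆-algebra on
which left multiplications are bounded. -/
theorem exists_isGNS [StarModule ℂ R] {φ : R →ₗ[ℂ] ℂ} (hφ : ∀ x, 0 ≤ φ (star x * x))
    (hb : ∀ x, ∃ C : ℝ, ∀ y, φ (star (x * y) * (x * y)) ≤ C * φ (star y * y)) :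
    ∃ (H : Type w) (_ : NormedAddCommGroup H) (_ : InnerProductSpace ℂ H)
      (_ : CompleteSpace H) (π : R →⋆ₐ[ℂ] (H →L[ℂ] H)) (ξ : H), IsGNS φ π ξ := by
  let c : PreInnerProductSpace.Core ℂ R :=
    { inner := fun a b => φ (star a * b)
      conj_inner_symm := fun a b => by
        change star (φ _) = _
        rw [← LinearMap.map_star_of_nonneg_star_mul_self hφ, star_mul, star_star]
      re_inner_nonneg := fun a => (Complex.nonneg_iff.mp (hφ a)).1
      add_left := fun a b d => by
        change φ _ = φ _ + φ _
        rw [star_add, add_mul, map_add]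
      smul_left := fun a b r => by
        change φ _ = star r * φ _
        rw [star_smul, smul_mul_assoc, map_smul, smul_eq_mul] }
  let i1 : SeminormedAddCommGroup R := InnerProductSpace.Core.toSeminormedAddCommGroup (c := c)
  let i2 : InnerProductSpace ℂ R := InnerProductSpace.ofCore c
  have inner_def : ∀ a b : R, inner ℂ a b = φ (star a * b) := fun _ _ => rfl
  have norm_sq : ∀ a : R, ((‖a‖ ^ 2 : ℝ) : ℂ) = φ (star a * a) := fun a => by
    rw [← inner_def, inner_self_eq_norm_sq_to_K]; simp
  have bound : ∀ x : R, ∃ C : ℝ, ∀ y : R, ‖LinearMap.mulLeft ℂ x y‖ ≤ C * ‖y‖ := by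
    intro x
    obtain ⟨C, hC⟩ := hb x
    -- `C` may be negative, so it is truncated at `0` before the root is taken.
    refine ⟨√(max C 0), fun y => ?_⟩
    have h := hC y
    rw [← norm_sq, ← norm_sq, ← Complex.ofReal_mul, Complex.real_le_real] at h
    refine abs_le_of_sq_le_sq' ?_ (by positivity) |>.2
    rw [mul_pow, Real.sq_sqrt (le_max_right _ _)]
    exact h.trans (by gcongr; exact le_max_left _ _)
  let L : R → R →L[ℂ] R := fun x =>
    LinearMap.mkContinuousOfExistsBound (LinearMap.mulLeft ℂ x) (bound x)
  have L_apply : ∀ x y : R, L x y = x * y := fun _ _ => rfl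
  -- The completion is Hausdorff, so it also identifies null vectors with `0`; no quotient by the
  -- null space is formed.
  let H := UniformSpace.Completion R
  have ext_coe : ∀ S T : H →L[ℂ] H, (∀ y : R, S y = T y) → S = T := by
    intro S T h
    ext z
    induction z using UniformSpace.Completion.induction_on with
    | hp => exact isClosed_eq S.continuous T.continuous
    | ih y => exact h y
  have comp_coe : ∀ x y : R, (L x).completion (y : H) = ((x * y : R) : H) := fun x y => by
    rw [ContinuousLinearMap.completion_apply_coe, L_apply]
  let π : R →⋆ₐ[ℂ] (H →L[ℂ] H) :=
    { toFun := fun x => (L x).completion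
      map_one' := ext_coe _ _ fun y => by rw [comp_coe, one_mul]; rfl
      map_mul' := fun a b => ext_coe _ _ fun y => by
        rw [mul_apply_eq_comp, comp_coe, comp_coe, comp_coe, mul_assoc]
      map_zero' := ext_coe _ _ fun y => by
        rw [comp_coe, zero_mul, UniformSpace.Completion.coe_zero]; rfl
      map_add' := fun a b => ext_coe _ _ fun y => by
        rw [add_apply, comp_coe, comp_coe, comp_coe, add_mul,
          UniformSpace.Completion.coe_add]
      commutes' := fun r => ext_coe _ _ fun y => by
        rw [comp_coe, Algebra.algebraMap_eq_smul_one, Algebra.algebraMap_eq_smul_one,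
          smul_mul_assoc, one_mul, UniformSpace.Completion.coe_smul]
        rfl
      map_star' := fun a => by
        rw [ContinuousLinearMap.star_eq_adjoint]
        refine (ContinuousLinearMap.eq_adjoint_iff _ _).mpr fun x y => ?_
        induction x, y using UniformSpace.Completion.induction_on₂ with
        | hp => apply isClosed_eq <;> fun_prop
        | ih x y =>
          rw [comp_coe, comp_coe, UniformSpace.Completion.inner_coe,
            UniformSpace.Completion.inner_coe, inner_def, inner_def, star_mul, star_star,
            mul_assoc] }
  have π_apply : ∀ x : R, π x ((1 : R) : H) = ((x : R) : H) := fun x => by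
    change (L x).completion ((1 : R) : H) = _
    rw [comp_coe, mul_one]
  refine ⟨H, inferInstance, inferInstance, inferInstance, π, ((1 : R) : H), ?_, fun x => ?_⟩
  · simp only [π_apply]
    exact UniformSpace.Completion.denseRange_coe
  · rw [π_apply, UniformSpace.Completion.inner_coe, inner_def, star_one, one_mul]

lemma IsGNS.inner_apply_apply {φ : R →ₗ[ℂ] ℂ} {H : Type*} [NormedAddCommGroup H]
    [InnerProductSpace ℂ H] [CompleteSpace H] {π : R →⋆ₐ[ℂ] (H →L[ℂ] H)} {ξ : H}
    (h : IsGNS φ π ξ) (x y : R) : inner ℂ (π x ξ) (π y ξ) = φ (star x * y) := by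
  rw [← h.inner_eq, map_mul, map_star, ContinuousLinearMap.star_eq_adjoint,
    mul_apply_eq_comp, ContinuousLinearMap.adjoint_inner_right]

/-- In the C⋆-algebra, `‖a‖² - a* a = c* c` for some `c`. The difference of the two sides is then
the value of `φ` at the square of `ι c * y`. -/
lemma map_starAlgHom_mul_le {A : Type*} [CStarAlgebra A] (ι : A →⋆ₐ[ℂ] R) {φ : R →ₗ[ℂ] ℂ}
    (hφ : ∀ x, 0 ≤ φ (star x * x)) (a : A) (y : R) :
    φ (star (ι a * y) * (ι a * y)) ≤ (‖a‖ ^ 2 : ℝ) * φ (star y * y) := by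
  let := CStarAlgebra.spectralOrder A
  let := CStarAlgebra.spectralOrderedRing A
  have h : 0 ≤ algebraMap ℝ A (‖a‖ ^ 2) - star a * a :=
    sub_nonneg.mpr CStarAlgebra.star_mul_le_algebraMap_norm_sq
  obtain ⟨c, hc⟩ := CStarAlgebra.nonneg_iff_eq_star_mul_self.mp h
  have key := hφ (ι c * y)
  have h1 : star (ι c * y) * (ι c * y) =
      ((‖a‖ ^ 2 : ℝ) : ℂ) • (star y * y) - star (ι a * y) * (ι a * y) := by
    have : ι (star c * c) = ((‖a‖ ^ 2 : ℝ) : ℂ) • (1 : R) - star (ι a) * ι a := by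
      rw [← hc, map_sub, map_mul, map_star, IsScalarTower.algebraMap_apply ℝ ℂ A,
        Algebra.algebraMap_eq_smul_one (R := ℂ) (A := A), map_smul, map_one]
      rfl
    calc _ = star y * ι (star c * c) * y := by
          rw [map_mul, map_star, star_mul]; simp only [mul_assoc]
      _ = _ := by rw [this]; simp [mul_sub, sub_mul, mul_assoc]
  rw [h1, map_sub, map_smul, smul_eq_mul] at key
  exact sub_nonneg.mp key

end PositiveFunctional

/-! ### Norming states and even states -/

section State

variable {A : Type u} [CStarAlgebra A]

theorem IsState.exists_isGNS {φ : A →ₗ[ℂ] ℂ} (hφ : IsState φ) :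
    ∃ (H : Type u) (_ : NormedAddCommGroup H) (_ : InnerProductSpace ℂ H)
      (_ : CompleteSpace H) (π : A →⋆ₐ[ℂ] (H →L[ℂ] H)) (ξ : H), IsGNS φ π ξ :=
  _root_.exists_isGNS hφ.nonneg fun x =>
    ⟨‖x‖ ^ 2, fun y => map_starAlgHom_mul_le (StarAlgHom.id ℂ A) hφ.nonneg x y⟩

/-- For self-adjoint `a`, `|f (a + i t)|² ≤ ‖a‖² + t²` for all real `t` forces `f a` to be real. For
`h ≥ 0`, `‖‖h‖ - h‖ ≤ ‖h‖` then gives `‖h‖ - f h ≤ ‖h‖`. -/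
lemma isState_of_norm_le_one (f : StrongDual ℂ A) (hf : ‖f‖ ≤ 1) (h1 : f 1 = 1) :
    IsState (f : A →ₗ[ℂ] ℂ) := by
  have hnt : Nontrivial A := ⟨1, 0, fun h => by simp [h] at h1⟩
  have hle : ∀ x, ‖f x‖ ≤ ‖x‖ := fun x => (f.le_opNorm x).trans (by nlinarith [norm_nonneg x])
  have him : ∀ a : A, IsSelfAdjoint a → (f a).im = 0 := by
    intro a ha
    have key : ∀ t : ℝ, ((f a).im + t) ^ 2 ≤ ‖a‖ ^ 2 + t ^ 2 := by
      intro t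
      have e : ‖a + (t * Complex.I) • (1 : A)‖ ^ 2 ≤ ‖a‖ ^ 2 + t ^ 2 := by
        rw [sq, ← CStarRing.norm_star_mul_self]
        have : star (a + (t * Complex.I) • (1 : A)) * (a + (t * Complex.I) • (1 : A)) =
            a * a + ((t ^ 2 : ℝ) : ℂ) • (1 : A) := by
          rw [star_add, star_smul, star_one, ha.star_eq]
          simp only [add_mul, mul_add, smul_mul_assoc, mul_smul_comm, one_mul, mul_one,
            smul_add, smul_smul]
          have : star ((t : ℂ) * Complex.I) = -(t * Complex.I) := by simp
          have h2 : ((t : ℂ) * Complex.I) * (-(t * Complex.I)) = ((t ^ 2 : ℝ) : ℂ) := by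
            push_cast; linear_combination (-(t : ℂ) ^ 2) * Complex.I_sq
          rw [this, h2, neg_smul]
          abel
        rw [this]
        refine (norm_add_le _ _).trans ?_
        rw [norm_smul, norm_one, mul_one, Complex.norm_real, Real.norm_of_nonneg (sq_nonneg t), sq]
        gcongr
        simpa [sq] using norm_mul_le a a
      have h2 : (f a).im + t = (f (a + (t * Complex.I) • (1 : A))).im := by simp [h1]
      rw [h2]
      refine le_trans ?_ e
      rw [← sq_abs]
      gcongr
      exact (Complex.abs_im_le_norm _).trans (hle _)
    by_contra hne
    -- This `t` makes the cross term `2 t Im (f a)` equal to `2 (‖a‖² + 1)`, more than the bound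
    -- allows.
    have := key ((‖a‖ ^ 2 + 1) / (f a).im)
    have h3 : (f a).im * ((‖a‖ ^ 2 + 1) / (f a).im) = ‖a‖ ^ 2 + 1 := by field_simp
    nlinarith [sq_nonneg (f a).im, sq_nonneg ‖a‖]
  refine ⟨fun a => ?_, h1⟩
  let := CStarAlgebra.spectralOrder A
  let := CStarAlgebra.spectralOrderedRing A
  set h := star a * a with hh
  have hsa : IsSelfAdjoint h := IsSelfAdjoint.star_mul_self a
  have hpos : 0 ≤ h := star_mul_self_nonneg a
  refine Complex.nonneg_iff.mpr ⟨?_, (him h hsa).symm⟩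
  have hn : ‖algebraMap ℝ A ‖h‖ - h‖ ≤ ‖h‖ := by
    refine (CStarAlgebra.norm_le_iff_le_algebraMap _ (norm_nonneg _) ?_).mpr ?_
    · exact sub_nonneg.mpr hsa.le_algebraMap_norm_self
    · exact sub_le_self _ hpos
  have h4 := (Complex.abs_re_le_norm _).trans ((hle _).trans hn)
  rw [IsScalarTower.algebraMap_apply ℝ ℂ A, Algebra.algebraMap_eq_smul_one (R := ℂ) (A := A),
    map_sub, map_smul, h1] at h4
  simp only [Complex.coe_algebraMap, smul_eq_mul, mul_one, Complex.sub_re,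
    Complex.ofReal_re] at h4
  have := (abs_le.mp h4).2
  change 0 ≤ (f h).re
  linarith

/-- With `h = a* a`, the number `‖h‖` lies in the spectrum of `h`, so `|p(‖h‖)| ≤ ‖p(h)‖` by
spectral mapping. Thus `p(h) ↦ p(‖h‖)` is a well-defined contraction on the polynomials in `h`; its
Hahn–Banach extension is the state. -/
theorem exists_isState_apply_star_mul_self [Nontrivial A] (a : A) :
    ∃ φ : A →ₗ[ℂ] ℂ, IsState φ ∧ φ (star a * a) = (‖a‖ ^ 2 : ℝ) := by
  let := CStarAlgebra.spectralOrder A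
  let := CStarAlgebra.spectralOrderedRing A
  set h := star a * a with hh
  have hpos : 0 ≤ h := star_mul_self_nonneg a
  have hnorm : ‖h‖ = ‖a‖ ^ 2 := by rw [hh, CStarRing.norm_star_mul_self, sq]
  have hspec : ((‖h‖ : ℝ) : ℂ) ∈ spectrum ℂ h := by
    have := CStarAlgebra.norm_mem_spectrum_of_nonneg hpos
    exact spectrum.algebraMap_mem ℂ this
  have hbd : ∀ p : Polynomial ℂ, ‖p.eval ((‖h‖ : ℝ) : ℂ)‖ ≤ ‖Polynomial.aeval h p‖ := fun p =>
    spectrum.norm_le_norm_of_mem (spectrum.subset_polynomial_aeval h p ⟨_, hspec, rfl⟩)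
  let T : Polynomial ℂ →ₗ[ℂ] A := (Polynomial.aeval h).toLinearMap
  let E : Polynomial ℂ →ₗ[ℂ] ℂ := (Polynomial.aeval ((‖h‖ : ℝ) : ℂ)).toLinearMap
  have hker : LinearMap.ker T ≤ LinearMap.ker E := by
    intro p hp
    have h1 := hbd p
    have h2 : Polynomial.aeval h p = 0 := hp
    rw [h2, norm_zero] at h1
    have h3 : p.eval ((‖h‖ : ℝ) : ℂ) = 0 := norm_le_zero_iff.mp h1
    simpa [E, Polynomial.aeval_def] using h3
  let F : LinearMap.range T →ₗ[ℂ] ℂ :=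
    (LinearMap.ker T).liftQ E hker ∘ₗ T.quotKerEquivRange.symm.toLinearMap
  have F_apply : ∀ (p : Polynomial ℂ) (hp : T p ∈ LinearMap.range T), F ⟨T p, hp⟩ = E p := by
    intro p hp
    have : T.quotKerEquivRange.symm ⟨T p, hp⟩ = (LinearMap.ker T).mkQ p := by
      rw [LinearEquiv.symm_apply_eq]; rfl
    simp only [F, LinearMap.comp_apply, LinearEquiv.coe_coe, this]
    rfl
  have F_bd : ∀ x, ‖F x‖ ≤ 1 * ‖x‖ := by
    rintro ⟨_, p, rfl⟩
    rw [F_apply p (LinearMap.mem_range_self T p), one_mul]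
    simpa [E, T, Polynomial.aeval_def] using hbd p
  obtain ⟨g, hg, hgn⟩ := exists_extension_norm_eq (LinearMap.range T) (F.mkContinuous 1 F_bd)
  have g_apply : ∀ p, g (T p) = E p := fun p =>
    (hg ⟨T p, p, rfl⟩).trans (F_apply p _)
  refine ⟨g, isState_of_norm_le_one g ?_ ?_, ?_⟩
  · rw [hgn]; exact F.mkContinuous_norm_le zero_le_one F_bd
  · simpa [T, E] using g_apply 1
  · simpa [T, E, hnorm] using g_apply Polynomial.X

/-- The state is `(φ + φ ∘ θ) / 2` with `φ` norming at `a* a`. The term `φ ∘ θ` is only known to be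
nonnegative there, whence the factor `1/2`; for homogeneous `a` the element `a* a` is even and both
terms agree. -/
theorem exists_isEvenState_apply_star_mul_self [Nontrivial A] (g : Z2Grading A) (a : A) :
    ∃ φ : A →ₗ[ℂ] ℂ, IsEvenState g φ ∧ (‖a‖ ^ 2 / 2 : ℝ) ≤ φ (star a * a) ∧
      (g.IsHomogeneous a → φ (star a * a) = (‖a‖ ^ 2 : ℝ)) := by
  obtain ⟨φ, hφ, ha⟩ := exists_isState_apply_star_mul_self a
  let ψ : A →ₗ[ℂ] ℂ := (2⁻¹ : ℂ) • (φ + φ ∘ₗ g.θ.toAlgEquiv.toLinearMap)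
  have ψ_apply : ∀ x, ψ x = 2⁻¹ * (φ x + φ (g.θ x)) := fun _ => rfl
  have h2 : (0 : ℂ) ≤ 2⁻¹ := by simp
  have hθ : ∀ x, 0 ≤ φ (g.θ (star x * x)) := fun x => by
    rw [map_mul, map_star]; exact hφ.nonneg _
  refine ⟨ψ, ⟨⟨fun x => ?_, ?_⟩, fun x => ?_⟩, ?_, fun h => ?_⟩
  · rw [ψ_apply]
    exact mul_nonneg h2 (add_nonneg (hφ.nonneg x) (hθ x))
  · rw [ψ_apply, map_one g.θ, hφ.map_one]; norm_num
  · rw [ψ_apply, ψ_apply, g.involutive, add_comm]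
  · rw [ψ_apply, ha, mul_add]
    refine le_trans (le_of_eq ?_) (le_add_of_nonneg_right (mul_nonneg h2 (hθ a)))
    push_cast; ring
  · obtain ⟨i, hi⟩ := h
    have : g.θ (star a * a) = star a * a := by
      rw [map_mul, map_star, hi, star_smul, smul_mul_smul_comm]
      obtain rfl | rfl := Z2Grading.zmod_two_cases i <;> simp [gradeSign]
    rw [ψ_apply, this, ha, ← two_mul]
    simp

end State


variable {A : Type u} [CStarAlgebra A] {B : Type v} [CStarAlgebra B]

/-! ### Embeddings of the factors and uniform bounds on representations -/

namespace FermiProduct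

variable (g₁ : Z2Grading A) (g₂ : Z2Grading B)

/-- The elementary tensor as a bilinear map. -/
def tmulₗ : A →ₗ[ℂ] B →ₗ[ℂ] FermiProduct g₁ g₂ :=
  (TensorProduct.mk ℂ A B).compr₂ (GradedTensorProduct.of ℂ g₁.part g₂.part).toLinearMap

@[simp]
lemma tmulₗ_apply (a : A) (b : B) : tmulₗ g₁ g₂ a b = tmul g₁ g₂ a b := rfl

lemma add_tmul (a a' : A) (b : B) :
    tmul g₁ g₂ (a + a') b = tmul g₁ g₂ a b + tmul g₁ g₂ a' b := by
  simp [← tmulₗ_apply]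

lemma tmul_add (a : A) (b b' : B) :
    tmul g₁ g₂ a (b + b') = tmul g₁ g₂ a b + tmul g₁ g₂ a b' := by
  simp [← tmulₗ_apply]

lemma tmul_one_one : tmul g₁ g₂ 1 1 = 1 := rfl

variable {g₁ g₂} in
lemma zero_tmul (b : B) : tmul g₁ g₂ 0 b = 0 := by
  rw [← tmulₗ_apply, map_zero, LinearMap.zero_apply]

variable {g₁ g₂} in
lemma tmul_zero (a : A) : tmul g₁ g₂ a 0 = 0 := by
  rw [← tmulₗ_apply, map_zero]

lemma tmul_one_mul_one_tmul (a : A) (b : B) :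
    tmul g₁ g₂ a 1 * tmul g₁ g₂ 1 b = tmul g₁ g₂ a b := by
  rw [tmul_mul_tmul a b (SetLike.GradedOne.one_mem : (1 : B) ∈ g₂.part 0)
    (SetLike.GradedOne.one_mem : (1 : A) ∈ g₁.part 0)]
  simp [fermiSign]

/-- The ⋆-homomorphism `a ↦ a ⊗ 1`. -/
def inl : A →⋆ₐ[ℂ] FermiProduct g₁ g₂ where
  __ := GradedTensorProduct.includeLeft g₁.part g₂.part
  map_star' a := by
    change tmul g₁ g₂ (star a) 1 = star (tmul g₁ g₂ a 1)
    have h (i : ZMod 2) :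
        tmul g₁ g₂ (star (g₁.proj i a)) 1 = star (tmul g₁ g₂ (g₁.proj i a) 1) := by
      rw [star_tmul (g₁.proj_mem i a) (SetLike.GradedOne.one_mem : (1 : B) ∈ g₂.part 0), star_one]
      simp [fermiSign]
    rw [← g₁.proj_zero_add_proj_one a, star_add, add_tmul, add_tmul, star_add, h, h]

/-- The ⋆-homomorphism `b ↦ 1 ⊗ b`. -/
def inr : B →⋆ₐ[ℂ] FermiProduct g₁ g₂ where
  __ := GradedTensorProduct.includeRight g₁.part g₂.part
  map_star' b := by
    change tmul g₁ g₂ 1 (star b) = star (tmul g₁ g₂ 1 b)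
    have h (i : ZMod 2) :
        tmul g₁ g₂ 1 (star (g₂.proj i b)) = star (tmul g₁ g₂ 1 (g₂.proj i b)) := by
      rw [star_tmul (SetLike.GradedOne.one_mem : (1 : A) ∈ g₁.part 0) (g₂.proj_mem i b), star_one]
      simp [fermiSign]
    rw [← g₂.proj_zero_add_proj_one b, star_add, tmul_add, tmul_add, star_add, h, h]

lemma inl_mul_inr (a : A) (b : B) : inl g₁ g₂ a * inr g₁ g₂ b = tmul g₁ g₂ a b :=
  tmul_one_mul_one_tmul g₁ g₂ a b

variable {g₁ g₂}

lemma norm_map_tmul_le {H : Type*} [NormedAddCommGroup H] [InnerProductSpace ℂ H]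
    [CompleteSpace H] (π : FermiProduct g₁ g₂ →⋆ₐ[ℂ] (H →L[ℂ] H)) (a : A) (b : B) :
    ‖π (tmul g₁ g₂ a b)‖ ≤ ‖a‖ * ‖b‖ := by
  rw [← inl_mul_inr, map_mul]
  refine (norm_mul_le _ _).trans ?_
  gcongr
  · exact NonUnitalStarAlgHom.norm_apply_le (π.comp (inl g₁ g₂)) a
  · exact NonUnitalStarAlgHom.norm_apply_le (π.comp (inr g₁ g₂)) b

/-- The norms `‖π x‖` are bounded uniformly in the representation `π`. -/
lemma exists_norm_map_le (x : FermiProduct g₁ g₂) :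
    ∃ C : ℝ, ∀ (H : Type w) [NormedAddCommGroup H] [InnerProductSpace ℂ H] [CompleteSpace H]
      (π : FermiProduct g₁ g₂ →⋆ₐ[ℂ] (H →L[ℂ] H)), ‖π x‖ ≤ C := by
  induction x using induction_homogeneous with
  | h0 => exact ⟨0, fun H _ _ _ π => by simp⟩
  | ht i j a b _ _ => exact ⟨‖a‖ * ‖b‖, fun H _ _ _ π => norm_map_tmul_le π a b⟩
  | ha x y hx hy =>
    obtain ⟨C, hC⟩ := hx
    obtain ⟨D, hD⟩ := hy
    refine ⟨C + D, fun H _ _ _ π => ?_⟩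
    rw [map_add]
    exact (norm_add_le _ _).trans (add_le_add (hC H π) (hD H π))

end FermiProduct

open FermiProduct

lemma IsEvenState.apply_eq_zero {g : Z2Grading A} {φ : A →ₗ[ℂ] ℂ} (hφ : IsEvenState g φ) {a : A}
    (ha : a ∈ g.part 1) : φ a = 0 := by
  have h := hφ.even a
  rw [g.mem_part.mp ha] at h
  simp only [gradeSign, one_ne_zero, if_false, map_smul, smul_eq_mul] at h
  linear_combination (-1 / 2 : ℂ) * h

/-! ### Positivity and GNS representations of products of even states -/

section ProductState

variable {g₁ : Z2Grading A} {g₂ : Z2Grading B} {ω₁ : A →ₗ[ℂ] ℂ} {ω₂ : B →ₗ[ℂ] ℂ}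

@[simp]
lemma prodFunctional_tmul (a : A) (b : B) :
    prodFunctional g₁ g₂ ω₁ ω₂ (tmul g₁ g₂ a b) = ω₁ a * ω₂ b := rfl

/-- The signs of the Fermi product cancel under an even product functional. -/
lemma prodFunctional_star_tmul_mul_tmul_of_mem (h₁ : IsEvenState g₁ ω₁)
    {i j k : ZMod 2} {a a' : A} {b : B} (b' : B) (ha : a ∈ g₁.part i) (hb : b ∈ g₂.part j)
    (ha' : a' ∈ g₁.part k) :
    prodFunctional g₁ g₂ ω₁ ω₂ (star (tmul g₁ g₂ a b) * tmul g₁ g₂ a' b') =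
      ω₁ (star a * a') * ω₂ (star b * b') := by
  rw [star_tmul ha hb, smul_mul_assoc, tmul_mul_tmul _ _ (g₂.star_mem hb) ha', map_smul, map_smul,
    prodFunctional_tmul, smul_smul, smul_eq_mul]
  have hA : star a * a' ∈ g₁.part (i + k) := SetLike.mul_mem_graded (g₁.star_mem ha) ha'
  -- If `a* a'` is odd, both sides vanish; otherwise `i = k` and the two signs are equal and cancel.
  by_cases hik : i + k = 1
  · rw [h₁.apply_eq_zero (hik ▸ hA)]; simp
  · have : fermiSign i j * fermiSign j k = 1 := by
      obtain rfl | rfl := Z2Grading.zmod_two_cases i <;>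
        obtain rfl | rfl := Z2Grading.zmod_two_cases j <;>
        obtain rfl | rfl := Z2Grading.zmod_two_cases k <;> simp [fermiSign] at hik ⊢
    rw [this, one_mul]

variable {H₁ : Type*} [NormedAddCommGroup H₁] [InnerProductSpace ℂ H₁] [CompleteSpace H₁]
  {H₂ : Type*} [NormedAddCommGroup H₂] [InnerProductSpace ℂ H₂] [CompleteSpace H₂]

/-- The linear map `x ↦ π x ξ`. -/
def orbitMap {R : Type w} [Ring R] [Algebra ℂ R] [StarRing R] (π : R →⋆ₐ[ℂ] (H₁ →L[ℂ] H₁))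
    (ξ : H₁) : R →ₗ[ℂ] H₁ where
  toFun x := π x ξ
  map_add' x y := by rw [map_add, add_apply]
  map_smul' c x := by rw [map_smul]; rfl

lemma prodFunctional_star_mul_eq_inner (h₁ : IsEvenState g₁ ω₁)
    {π₁ : A →⋆ₐ[ℂ] (H₁ →L[ℂ] H₁)} {ξ₁ : H₁} (hπ₁ : IsGNS ω₁ π₁ ξ₁)
    {π₂ : B →⋆ₐ[ℂ] (H₂ →L[ℂ] H₂)} {ξ₂ : H₂} (hπ₂ : IsGNS ω₂ π₂ ξ₂) (x y : FermiProduct g₁ g₂) :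
    prodFunctional g₁ g₂ ω₁ ω₂ (star x * y) =
      inner ℂ (TensorProduct.map (orbitMap π₁ ξ₁) (orbitMap π₂ ξ₂)
          ((GradedTensorProduct.of ℂ g₁.part g₂.part).symm x))
        (TensorProduct.map (orbitMap π₁ ξ₁) (orbitMap π₂ ξ₂)
          ((GradedTensorProduct.of ℂ g₁.part g₂.part).symm y)) := by
  induction x using induction_homogeneous with
  | h0 => simp
  | ha x x' hx hx' =>
    rw [star_add, add_mul, map_add, hx, hx', map_add, map_add, inner_add_left]
  | ht i j a b ha hb =>
    induction y using induction_homogeneous with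
    | h0 => simp
    | ha y y' hy hy' => rw [mul_add, map_add, hy, hy', map_add, map_add, inner_add_right]
    | ht k l a' b' ha' _ =>
      rw [prodFunctional_star_tmul_mul_tmul_of_mem h₁ b' ha hb ha', tmul, tmul,
        GradedTensorProduct.of_symm_of, GradedTensorProduct.of_symm_of, TensorProduct.map_tmul,
        TensorProduct.map_tmul, TensorProduct.inner_tmul, ← hπ₁.inner_apply_apply,
        ← hπ₂.inner_apply_apply]
      rfl

/-- The inner product formula carries no signs, so the homogeneity assumptions can be dropped. -/
lemma prodFunctional_star_tmul_mul_tmul (h₁ : IsEvenState g₁ ω₁) (h₂ : IsEvenState g₂ ω₂)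
    (a a' : A) (b b' : B) :
    prodFunctional g₁ g₂ ω₁ ω₂ (star (tmul g₁ g₂ a b) * tmul g₁ g₂ a' b') =
      ω₁ (star a * a') * ω₂ (star b * b') := by
  obtain ⟨H₁, _, _, _, π₁, ξ₁, hπ₁⟩ := h₁.toIsState.exists_isGNS
  obtain ⟨H₂, _, _, _, π₂, ξ₂, hπ₂⟩ := h₂.toIsState.exists_isGNS
  rw [prodFunctional_star_mul_eq_inner h₁ hπ₁ hπ₂, tmul, tmul,
    GradedTensorProduct.of_symm_of, GradedTensorProduct.of_symm_of, TensorProduct.map_tmul,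
    TensorProduct.map_tmul, TensorProduct.inner_tmul, ← hπ₁.inner_apply_apply,
    ← hπ₂.inner_apply_apply]
  rfl

theorem prodFunctional_star_mul_self_nonneg (h₁ : IsEvenState g₁ ω₁) (h₂ : IsEvenState g₂ ω₂)
    (x : FermiProduct g₁ g₂) : 0 ≤ prodFunctional g₁ g₂ ω₁ ω₂ (star x * x) := by
  obtain ⟨H₁, _, _, _, π₁, ξ₁, hπ₁⟩ := h₁.toIsState.exists_isGNS
  obtain ⟨H₂, _, _, _, π₂, ξ₂, hπ₂⟩ := h₂.toIsState.exists_isGNS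
  rw [prodFunctional_star_mul_eq_inner h₁ hπ₁ hπ₂]
  refine le_of_le_of_eq ?_ (inner_self_eq_norm_sq_to_K (𝕜 := ℂ) (E := H₁ ⊗[ℂ] H₂) _).symm
  rw [RCLike.ofReal_eq_complex_ofReal, ← Complex.ofReal_pow]
  exact Complex.zero_le_real.mpr (sq_nonneg _)

/-- The product of two even states has a GNS representation by bounded operators. -/
theorem exists_isGNS_prodFunctional (h₁ : IsEvenState g₁ ω₁) (h₂ : IsEvenState g₂ ω₂) :
    ∃ (H : Type (max u v)) (_ : NormedAddCommGroup H) (_ : InnerProductSpace ℂ H)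
      (_ : CompleteSpace H) (π : FermiProduct g₁ g₂ →⋆ₐ[ℂ] (H →L[ℂ] H)) (ξ : H),
      IsGNS (prodFunctional g₁ g₂ ω₁ ω₂) π ξ := by
  have hpos := prodFunctional_star_mul_self_nonneg (g₁ := g₁) (g₂ := g₂) h₁ h₂
  set φ := prodFunctional g₁ g₂ ω₁ ω₂
  refine exists_isGNS hpos fun x => ?_
  suffices ∃ C : ℝ, 0 ≤ C ∧ ∀ y, φ (star (x * y) * (x * y)) ≤ C * φ (star y * y) from
    this.imp fun C hC => hC.2
  induction x using induction_homogeneous with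
  | h0 => exact ⟨0, le_rfl, fun y => by simp⟩
  | ht i j a b _ _ =>
    refine ⟨‖a‖ ^ 2 * ‖b‖ ^ 2, by positivity, fun y => ?_⟩
    rw [← inl_mul_inr, mul_assoc]
    refine (map_starAlgHom_mul_le (inl g₁ g₂) hpos a _).trans ?_
    rw [Complex.ofReal_mul, mul_assoc]
    refine mul_le_mul_of_nonneg_left (map_starAlgHom_mul_le (inr g₁ g₂) hpos b y) ?_
    exact_mod_cast sq_nonneg ‖a‖
  | ha x x' hx hx' =>
    obtain ⟨C, hC0, hC⟩ := hx
    obtain ⟨D, hD0, hD⟩ := hx'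
    -- From the parallelogram law: `‖u + v‖² ≤ 2‖u‖² + 2‖v‖²` in the seminorm of `φ`.
    refine ⟨2 * (C + D), by positivity, fun y => ?_⟩
    have h := hpos (x * y - x' * y)
    have e : star ((x + x') * y) * ((x + x') * y) + star (x * y - x' * y) * (x * y - x' * y) =
        (2 : ℂ) • (star (x * y) * (x * y)) + (2 : ℂ) • (star (x' * y) * (x' * y)) := by
      simp only [add_mul, star_add, star_sub, mul_add, mul_sub, sub_mul, two_smul]
      abel
    have e' := congrArg φ e
    simp only [map_add, map_smul, smul_eq_mul] at e'
    have h2 : (0 : ℂ) ≤ 2 := by norm_num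
    calc φ (star ((x + x') * y) * ((x + x') * y))
        ≤ φ (star ((x + x') * y) * ((x + x') * y)) +
          φ (star (x * y - x' * y) * (x * y - x' * y)) := le_add_of_nonneg_right h
      _ = 2 * φ (star (x * y) * (x * y)) + 2 * φ (star (x' * y) * (x' * y)) := e'
      _ ≤ 2 * (C * φ (star y * y)) + 2 * (D * φ (star y * y)) :=
        add_le_add (mul_le_mul_of_nonneg_left (hC y) h2) (mul_le_mul_of_nonneg_left (hD y) h2)
      _ = ((2 * (C + D) : ℝ) : ℂ) * φ (star y * y) := by push_cast; ring

end ProductState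

/-! ### Separation of points by even states and their products -/

lemma eq_zero_of_forall_isEvenState [Nontrivial A] (g : Z2Grading A) {a : A}
    (h : ∀ φ, IsEvenState g φ → φ (star a * a) = 0) : a = 0 := by
  obtain ⟨φ, hφ, hle, -⟩ := exists_isEvenState_apply_star_mul_self g a
  rw [h φ hφ] at hle
  have : ‖a‖ ^ 2 / 2 ≤ 0 := by exact_mod_cast hle
  exact norm_eq_zero.mp (pow_eq_zero_iff two_ne_zero |>.mp (by nlinarith [sq_nonneg ‖a‖]))

/-- The products of even states separate the points of the Fermi product. -/
theorem FermiProduct.eq_zero_of_prodFunctional [Nontrivial A] [Nontrivial B] {g₁ : Z2Grading A}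
    {g₂ : Z2Grading B} {x : FermiProduct g₁ g₂}
    (h : ∀ ω₁ ω₂, IsEvenState g₁ ω₁ → IsEvenState g₂ ω₂ → ∀ a b,
      prodFunctional g₁ g₂ ω₁ ω₂ (star (tmul g₁ g₂ a b) * x) = 0) : x = 0 := by
  let t : A ⊗[ℂ] B := (GradedTensorProduct.of ℂ g₁.part g₂.part).symm x
  -- Slice maps `f ⊗ id` and `id ⊗ f`; they reduce separation on the tensor product to separation on
  -- each factor.
  let L (f : A →ₗ[ℂ] ℂ) : A ⊗[ℂ] B →ₗ[ℂ] B := TensorProduct.lid ℂ B ∘ₗ f.rTensor B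
  let M (f : B →ₗ[ℂ] ℂ) : A ⊗[ℂ] B →ₗ[ℂ] A := TensorProduct.rid ℂ A ∘ₗ f.lTensor A
  have hL : ∀ ω₁, IsEvenState g₁ ω₁ → ∀ a, L (ω₁ ∘ₗ LinearMap.mulLeft ℂ (star a)) t = 0 := by
    intro ω₁ h₁ a
    refine eq_zero_of_forall_isEvenState g₂ fun ω₂ h₂ => ?_
    -- The slice `b` is itself used as the second leg of the test tensor, so that `ω₂ (b* b)` is one
    -- of the values assumed to vanish.
    generalize hb : L (ω₁ ∘ₗ LinearMap.mulLeft ℂ (star a)) t = b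
    have e : ω₂ ∘ₗ LinearMap.mulLeft ℂ (star b) ∘ₗ L (ω₁ ∘ₗ LinearMap.mulLeft ℂ (star a)) =
        prodFunctional g₁ g₂ ω₁ ω₂ ∘ₗ LinearMap.mulLeft ℂ (star (tmul g₁ g₂ a b)) ∘ₗ
          (GradedTensorProduct.of ℂ g₁.part g₂.part).toLinearMap := by
      refine TensorProduct.ext' fun a' b' => ?_
      refine Eq.trans ?_ (prodFunctional_star_tmul_mul_tmul h₁ h₂ a a' b b').symm
      simp [L]
    have e' := LinearMap.congr_fun e t
    simp only [LinearMap.comp_apply, hb] at e'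
    exact e'.trans (h ω₁ ω₂ h₁ h₂ a b)
  -- Here `f` is an arbitrary functional: `ω₁ (c* · M f t)` is `f` applied to a slice already known
  -- to be zero.
  have hM : ∀ f, M f t = 0 := by
    intro f
    refine eq_zero_of_forall_isEvenState g₁ fun ω₁ h₁ => ?_
    generalize hc : M f t = c
    have e : ω₁ ∘ₗ LinearMap.mulLeft ℂ (star c) ∘ₗ M f =
        f ∘ₗ L (ω₁ ∘ₗ LinearMap.mulLeft ℂ (star c)) := by
      refine TensorProduct.ext' fun a' b' => ?_
      simp [L, M, mul_comm]
    have e' := LinearMap.congr_fun e t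
    simp only [LinearMap.comp_apply, hL ω₁ h₁ c, hc, map_zero] at e'
    exact e'
  let 𝒞 := Module.Basis.ofVectorSpace ℂ B
  classical
  -- The coefficients of `t` in a basis of `B` are its slices along the coordinate functionals.
  have ht : t = 0 := by
    refine (TensorProduct.equivFinsuppOfBasisRight 𝒞).injective ?_
    ext i
    rw [TensorProduct.equivFinsuppOfBasisRight_apply, map_zero]
    exact hM (𝒞.coord i)
  exact (GradedTensorProduct.of ℂ g₁.part g₂.part).symm.map_eq_zero_iff.mp ht

/-! ### Suprema of C⋆-seminorms -/

section Supremum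

variable {R : Type w} [Ring R] [Algebra ℂ R] [StarRing R]

/-- A pointwise bounded separating family of C⋆-seminorms has a C⋆-norm as its supremum. -/
theorem isCStarNorm_sSup {P : Set (R → ℝ)} (h0 : ∀ p ∈ P, ∀ x, 0 ≤ p x)
    (hadd : ∀ p ∈ P, ∀ x y, p (x + y) ≤ p x + p y)
    (hsmul : ∀ p ∈ P, ∀ (c : ℂ) (x : R), p (c • x) = ‖c‖ * p x)
    (hmul : ∀ p ∈ P, ∀ x y, p (x * y) ≤ p x * p y)
    (hstar : ∀ p ∈ P, ∀ x, p (star x * x) = p x ^ 2)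
    (hbdd : ∀ x, BddAbove ((fun p => p x) '' P))
    (hsep : ∀ x, (∀ p ∈ P, p x = 0) → x = 0) :
    IsCStarNorm fun x => sSup ((fun p => p x) '' P) := by
  have hle : ∀ p ∈ P, ∀ x, p x ≤ sSup ((fun p => p x) '' P) := fun p hp x =>
    le_csSup (hbdd x) ⟨p, hp, rfl⟩
  have hnn : ∀ x, 0 ≤ sSup ((fun p => p x) '' P) := fun x =>
    Real.sSup_nonneg (by rintro _ ⟨p, hp, rfl⟩; exact h0 p hp x)
  -- The condition `0 ≤ r` covers empty `P`, where `sSup ∅ = 0`; this occurs for the spatial family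
  -- of a zero algebra.
  have sup_le : ∀ (x : R) (r : ℝ), 0 ≤ r → (∀ p ∈ P, p x ≤ r) →
      sSup ((fun p => p x) '' P) ≤ r := fun x r hr h =>
    Real.sSup_le (by rintro _ ⟨p, hp, rfl⟩; exact h p hp) hr
  have smul_le : ∀ (c : ℂ) (x : R), sSup ((fun p => p (c • x)) '' P) ≤
      ‖c‖ * sSup ((fun p => p x) '' P) := fun c x =>
    sup_le _ _ (mul_nonneg (norm_nonneg c) (hnn x)) fun p hp => by
      rw [hsmul p hp]
      exact mul_le_mul_of_nonneg_left (hle p hp x) (norm_nonneg c)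
  refine ⟨fun x y => ?_, fun c x => ?_, fun x => ⟨fun h => ?_, ?_⟩, fun x y => ?_, fun x => ?_⟩
  · exact sup_le _ _ (add_nonneg (hnn x) (hnn y)) fun p hp =>
      (hadd p hp x y).trans (add_le_add (hle p hp x) (hle p hp y))
  · refine le_antisymm (smul_le c x) ?_
    rcases eq_or_ne c 0 with rfl | hc
    · simpa using hnn ((0 : ℂ) • x)
    -- The reverse inequality is the proved one for `c⁻¹` and `c • x`.
    · have := smul_le c⁻¹ (c • x)
      rw [inv_smul_smul₀ hc, norm_inv] at this
      exact (le_inv_mul_iff₀ (norm_pos_iff.mpr hc)).mp this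
  · exact hsep x fun p hp => le_antisymm (h ▸ hle p hp x) (h0 p hp x)
  · rintro rfl
    refine le_antisymm (sup_le _ _ le_rfl fun p hp => ?_) (hnn 0)
    simpa using (hsmul p hp 0 0).le
  · exact sup_le _ _ (mul_nonneg (hnn x) (hnn y)) fun p hp =>
      (hmul p hp x y).trans (mul_le_mul (hle p hp x) (hle p hp y) (h0 p hp y) (hnn x))
  · refine le_antisymm (sup_le _ _ (sq_nonneg _) fun p hp => ?_) ?_
    · rw [hstar p hp]
      exact pow_le_pow_left₀ (h0 p hp x) (hle p hp x) 2
    · refine (Real.le_sqrt (hnn x) (hnn _)).mp (sup_le _ _ (Real.sqrt_nonneg _) fun p hp => ?_)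
      refine Real.le_sqrt_of_sq_le ?_
      rw [← hstar p hp]
      exact hle p hp _

end Supremum

/-! ### The maximal and spatial families of seminorms -/

section Norms

variable (g₁ : Z2Grading A) (g₂ : Z2Grading B)

/-- The seminorms `x ↦ ‖π x‖` of the ⋆-representations of the Fermi product. -/
def repSeminorms : Set (FermiProduct g₁ g₂ → ℝ) :=
  {p | ∃ (H : Type (max u v)) (_ : NormedAddCommGroup H) (_ : InnerProductSpace ℂ H)
    (_ : CompleteSpace H) (π : FermiProduct g₁ g₂ →⋆ₐ[ℂ] (H →L[ℂ] H)), p = fun x => ‖π x‖}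

/-- The seminorms `x ↦ ‖π x‖` of the GNS representations of products of even states. -/
def spatialSeminorms : Set (FermiProduct g₁ g₂ → ℝ) :=
  {p | ∃ (ω₁ : A →ₗ[ℂ] ℂ) (ω₂ : B →ₗ[ℂ] ℂ) (_ : IsEvenState g₁ ω₁) (_ : IsEvenState g₂ ω₂)
    (H : Type (max u v)) (_ : NormedAddCommGroup H) (_ : InnerProductSpace ℂ H)
    (_ : CompleteSpace H) (π : FermiProduct g₁ g₂ →⋆ₐ[ℂ] (H →L[ℂ] H)) (ξ : H),
    IsGNS (prodFunctional g₁ g₂ ω₁ ω₂) π ξ ∧ p = fun x => ‖π x‖}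

lemma spatialSeminorms_subset : spatialSeminorms g₁ g₂ ⊆ repSeminorms g₁ g₂ := by
  rintro _ ⟨_, _, _, _, H, i₁, i₂, i₃, π, _, _, rfl⟩
  exact ⟨H, i₁, i₂, i₃, π, rfl⟩

lemma maxNormSet_eq_image (x : FermiProduct g₁ g₂) :
    maxNormSet g₁ g₂ x = (fun p => p x) '' repSeminorms g₁ g₂ := by
  ext r
  constructor
  · rintro ⟨H, i₁, i₂, i₃, π, rfl⟩
    exact ⟨_, ⟨H, i₁, i₂, i₃, π, rfl⟩, rfl⟩
  · rintro ⟨_, ⟨H, i₁, i₂, i₃, π, rfl⟩, rfl⟩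
    exact ⟨H, i₁, i₂, i₃, π, rfl⟩

lemma spatialNormSet_eq_image (x : FermiProduct g₁ g₂) :
    spatialNormSet g₁ g₂ x = (fun p => p x) '' spatialSeminorms g₁ g₂ := by
  ext r
  constructor
  · rintro ⟨ω₁, ω₂, h₁, h₂, H, i₁, i₂, i₃, π, ξ, hξ, rfl⟩
    exact ⟨_, ⟨ω₁, ω₂, h₁, h₂, H, i₁, i₂, i₃, π, ξ, hξ, rfl⟩, rfl⟩
  · rintro ⟨_, ⟨ω₁, ω₂, h₁, h₂, H, i₁, i₂, i₃, π, ξ, hξ, rfl⟩, rfl⟩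
    exact ⟨ω₁, ω₂, h₁, h₂, H, i₁, i₂, i₃, π, ξ, hξ, rfl⟩

variable {g₁ g₂}

lemma bddAbove_image_repSeminorms (x : FermiProduct g₁ g₂) :
    BddAbove ((fun p => p x) '' repSeminorms g₁ g₂) := by
  obtain ⟨C, hC⟩ := exists_norm_map_le x
  refine ⟨C, ?_⟩
  rintro _ ⟨_, ⟨H, _, _, _, π, rfl⟩, rfl⟩
  exact hC H π

lemma FermiProduct.eq_zero_of_subsingleton (h : Subsingleton A ∨ Subsingleton B)
    (x : FermiProduct g₁ g₂) : x = 0 := by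
  have h1 : (1 : FermiProduct g₁ g₂) = 0 := by
    rw [← tmul_one_one]
    rcases h with h | h
    · rw [Subsingleton.elim (1 : A) 0, zero_tmul]
    · rw [Subsingleton.elim (1 : B) 0, tmul_zero]
  rw [← one_mul x, h1, zero_mul]

/-- If `π x = 0` in the GNS representation, all `⟨π (a ⊗ b) ξ, π x ξ⟩` vanish, and these values
separate points. A zero factor has no states but makes the whole product zero. -/
lemma eq_zero_of_forall_spatialSeminorms (x : FermiProduct g₁ g₂)
    (h : ∀ p ∈ spatialSeminorms g₁ g₂, p x = 0) : x = 0 := by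
  rcases subsingleton_or_nontrivial A with hA | hA
  · exact eq_zero_of_subsingleton (.inl hA) x
  rcases subsingleton_or_nontrivial B with hB | hB
  · exact eq_zero_of_subsingleton (.inr hB) x
  refine eq_zero_of_prodFunctional fun ω₁ ω₂ h₁ h₂ a b => ?_
  obtain ⟨H, i₁, i₂, i₃, π, ξ, hξ⟩ := exists_isGNS_prodFunctional h₁ h₂
  have hx : π x = 0 := norm_eq_zero.mp (h _ ⟨ω₁, ω₂, h₁, h₂, H, i₁, i₂, i₃, π, ξ, hξ, rfl⟩)
  rw [← hξ.inner_apply_apply, hx, zero_apply, inner_zero_right]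

/-- The cyclic vector is a unit vector, and `‖π (a ⊗ b) ξ‖² = ω₁ (a* a) ω₂ (b* b) = ‖a‖² ‖b‖²`. -/
lemma norm_mul_norm_le_of_isGNS {ω₁ : A →ₗ[ℂ] ℂ} {ω₂ : B →ₗ[ℂ] ℂ} (h₁ : IsEvenState g₁ ω₁)
    (h₂ : IsEvenState g₂ ω₂) {H : Type*} [NormedAddCommGroup H] [InnerProductSpace ℂ H]
    [CompleteSpace H] {π : FermiProduct g₁ g₂ →⋆ₐ[ℂ] (H →L[ℂ] H)} {ξ : H}
    (hξ : IsGNS (prodFunctional g₁ g₂ ω₁ ω₂) π ξ) {a : A} {b : B}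
    (ha : ω₁ (star a * a) = (‖a‖ ^ 2 : ℝ)) (hb : ω₂ (star b * b) = (‖b‖ ^ 2 : ℝ)) :
    ‖a‖ * ‖b‖ ≤ ‖π (tmul g₁ g₂ a b)‖ := by
  have norm_sq (x : FermiProduct g₁ g₂) :
      ((‖π x ξ‖ ^ 2 : ℝ) : ℂ) = prodFunctional g₁ g₂ ω₁ ω₂ (star x * x) := by
    rw [← hξ.inner_apply_apply, inner_self_eq_norm_sq_to_K]; simp
  have hξ1 : ‖ξ‖ = 1 := by
    have := norm_sq 1
    rw [map_one, star_one, one_mul, ← tmul_one_one, prodFunctional_tmul, h₁.map_one, h₂.map_one,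
      mul_one, one_apply_eq_self] at this
    have : ‖ξ‖ ^ 2 = 1 := by exact_mod_cast this
    exact (pow_eq_one_iff_of_nonneg (norm_nonneg _) two_ne_zero).mp this
  have hab := norm_sq (tmul g₁ g₂ a b)
  rw [prodFunctional_star_tmul_mul_tmul h₁ h₂, ha, hb, ← Complex.ofReal_mul,
    Complex.ofReal_inj, ← mul_pow] at hab
  have hab' : ‖π (tmul g₁ g₂ a b) ξ‖ = ‖a‖ * ‖b‖ :=
    (pow_left_inj₀ (norm_nonneg _) (by positivity) two_ne_zero).mp hab
  rw [← hab']
  simpa [hξ1] using (π (tmul g₁ g₂ a b)).le_opNorm ξ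

/-- The supremum of a family of representation seminorms which contains the spatial ones is a
C⋆-cross norm. -/
theorem isCrossNorm_sSup {P : Set (FermiProduct g₁ g₂ → ℝ)} (hP : spatialSeminorms g₁ g₂ ⊆ P)
    (hP' : P ⊆ repSeminorms g₁ g₂) :
    IsCrossNorm g₁ g₂ fun x => sSup ((fun p => p x) '' P) := by
  have hbdd (x : FermiProduct g₁ g₂) : BddAbove ((fun p => p x) '' P) :=
    (bddAbove_image_repSeminorms x).mono (Set.image_mono hP')
  have hN : IsCStarNorm fun x : FermiProduct g₁ g₂ => sSup ((fun p => p x) '' P) := by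
    refine isCStarNorm_sSup ?_ ?_ ?_ ?_ ?_ hbdd
      fun x hx => eq_zero_of_forall_spatialSeminorms x fun p hp => hx p (hP hp)
    all_goals intro p hp; obtain ⟨H, _, _, _, π, rfl⟩ := hP' hp
    · exact fun x => norm_nonneg _
    · intro x y; simpa using norm_add_le (π x) (π y)
    · intro c x; simpa using norm_smul c (π x)
    · intro x y; simpa using norm_mul_le (π x) (π y)
    · intro x
      change ‖π (star x * x)‖ = ‖π x‖ ^ 2
      rw [map_mul, map_star, CStarRing.norm_star_mul_self, sq]
  refine ⟨hN, fun a b ha hb => le_antisymm ?_ ?_⟩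
  · refine Real.sSup_le ?_ (by positivity)
    rintro _ ⟨p, hp, rfl⟩
    obtain ⟨H, _, _, _, π, rfl⟩ := hP' hp
    exact norm_map_tmul_le π a b
  -- A zero algebra has no states to bound the supremum from below; there both sides are `0`.
  · have trivial_case (h : Subsingleton A ∨ Subsingleton B) :
        ‖a‖ * ‖b‖ ≤ sSup ((fun p => p (tmul g₁ g₂ a b)) '' P) := by
      refine le_of_eq_of_le ?_ ((hN.eq_zero_iff _).mpr (eq_zero_of_subsingleton h _)).ge
      rcases h with h | h
      · rw [Subsingleton.elim a 0, norm_zero, zero_mul]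
      · rw [Subsingleton.elim b 0, norm_zero, mul_zero]
    rcases subsingleton_or_nontrivial A with hA | hA
    · exact trivial_case (.inl hA)
    rcases subsingleton_or_nontrivial B with hB | hB
    · exact trivial_case (.inr hB)
    obtain ⟨ω₁, h₁, -, hω₁⟩ := exists_isEvenState_apply_star_mul_self g₁ a
    obtain ⟨ω₂, h₂, -, hω₂⟩ := exists_isEvenState_apply_star_mul_self g₂ b
    obtain ⟨H, i₁, i₂, i₃, π, ξ, hξ⟩ := exists_isGNS_prodFunctional h₁ h₂
    exact (norm_mul_norm_le_of_isGNS h₁ h₂ hξ (hω₁ ha) (hω₂ hb)).trans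
      (le_csSup (hbdd _) ⟨_, hP ⟨ω₁, ω₂, h₁, h₂, H, i₁, i₂, i₃, π, ξ, hξ, rfl⟩, rfl⟩)

end Norms

end

/-- The maximal norm and the spatial norm are (finite) C⋆-cross norms on the Fermi product. -/
theorem mainTheorem8 {A : Type u} [CStarAlgebra A] {B : Type v} [CStarAlgebra B]
    (g₁ : Z2Grading A) (g₂ : Z2Grading B) :
    ((∀ x, BddAbove (maxNormSet g₁ g₂ x)) ∧ IsCrossNorm g₁ g₂ (maxNorm g₁ g₂)) ∧
    ((∀ x, BddAbove (spatialNormSet g₁ g₂ x)) ∧ IsCrossNorm g₁ g₂ (spatialNorm g₁ g₂)) := by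
  refine ⟨⟨fun x => ?_, ?_⟩, fun x => ?_, ?_⟩
  · rw [maxNormSet_eq_image]
    exact bddAbove_image_repSeminorms x
  · have : maxNorm g₁ g₂ = fun x => sSup ((fun p => p x) '' repSeminorms g₁ g₂) :=
      funext fun x => by rw [maxNorm, maxNormSet_eq_image]
    rw [this]
    exact isCrossNorm_sSup (spatialSeminorms_subset g₁ g₂) subset_rfl
  · rw [spatialNormSet_eq_image]
    exact (bddAbove_image_repSeminorms x).mono (Set.image_mono (spatialSeminorms_subset g₁ g₂))
  · have : spatialNorm g₁ g₂ = fun x => sSup ((fun p => p x) '' spatialSeminorms g₁ g₂) :=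
      funext fun x => by rw [spatialNorm, spatialNormSet_eq_image]
    rw [this]
    exact isCrossNorm_sSup subset_rfl (spatialSeminorms_subset g₁ g₂)
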